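/- Let $s,v,m$ be positive integers and $\epsilon=\pm1$, with $vm^2>4$ if $\epsilon=-1$. Put \[ d=\frac{svm}{2},\qquad k=\frac{s^2v(vm^2+4\epsilon)}{4},\qquad \xi=d+\sqrt{k}, \] so that $\xi$ is a real quadratic irrational satisfying $\xi^2-t\xi-u=0$ with $t=svm$, $u=\epsilon s^2v$. Let $f_\xi(x)=2d+\dfrac{k-d^2}{x}$ be regarded as a map of $\mathbb{R}\cup\{\infty\}$ to itself. Call a fraction $p/q$ ($p,q\in\mathbb{Z}$) Pellian for $\xi$ if $q>0$, $p/q>t/2$ and $p^2-tpq-uq^2=\pm1$. Define $F_0=0$, $F_1=1$, $F_{n+1}=F_n+F_{n-1}$ and $G_0=0$, $G_1=1$, $G_{n+1}=2G_n+G_{n-1}$. Call $\xi$ exceptional if one of the following holds: (1) $\xi=r\cdot\frac{3+\sqrt5}{2}$ or $\xi=r\cdot\frac{5+\sqrt5}{2}$, where $r$ is a positive integer dividing $F_{2n+1}$ for some $n\ge0$; (2) $\xi=r(2+\sqrt2)$, where $r$ is a positive integer dividing $G_{2n+1}$ for some $n\ge0$. If $\xi$ is not exceptional, then the orbit $\{f_\xi^n(\infty)\}_{n\ge1}$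 contains every fraction that is Pellian for $\xi$ (in particular, every Pellian convergent of $\xi$). If $\xi$ is exceptional, then there is a fraction that is Pellian for $\xi$ and is a convergent of the simple continued fraction of $\xi$, but is not in this orbit. -/

import Mathlib

/-- The linear fractional transformation `x ↦ 2d + (k - d²)/x` of the real projective line
`ℝ ∪ {∞}`, which fixes `d ± √k`. It is the conjugate of `x ↦ (dx + k)/(x + d)` by the
translation by `d`. -/
noncomputable def lftXi (d k : ℝ) : OnePoint ℝ → OnePoint ℝ
  | none => ((2 * d : ℝ) : OnePoint ℝ)
  | some x =>
      open Classical in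
      if x = 0 then OnePoint.infty else ((2 * d + (k - d ^ 2) / x : ℝ) : OnePoint ℝ)

/-- The forward orbit `{f(∞), f(f(∞)), …}` of `∞`. -/
def orbitInfty (f : OnePoint ℝ → OnePoint ℝ) : Set (OnePoint ℝ) :=
  {y | ∃ n : ℕ, 1 ≤ n ∧ f^[n] OnePoint.infty = y}

/-- `p / q` is Pellian for the quadratic integer `ξ`, a root of `x² - tx - u` that exceeds the
absolute value of its conjugate `t - ξ`. -/
def IsPellian (ξ : ℝ) (p q : ℤ) : Prop :=
  ∃ t u : ℤ, ξ ^ 2 - t * ξ - u = 0 ∧ |(t : ℝ) - ξ| < ξ ∧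
    0 < q ∧ (t : ℝ) / 2 < (p : ℝ) / q ∧
    (p ^ 2 - t * p * q - u * q ^ 2 = 1 ∨ p ^ 2 - t * p * q - u * q ^ 2 = -1)

/-- `p / q` is a convergent of the simple continued fraction of `ξ`. -/
def IsConvergent (ξ : ℝ) (p q : ℤ) : Prop :=
  ∃ n : ℕ, ((p : ℚ) / q) = ξ.convergent n

/-- Pell numbers: `0, 1, 2, 5, 12, 29, …`. -/
def pellNumber : ℕ → ℕ
  | 0 => 0
  | 1 => 1
  | n + 2 => 2 * pellNumber (n + 1) + pellNumber n

/-- The exceptional values of `ξ`. -/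
def IsExceptional (ξ : ℝ) : Prop :=
  (∃ s n : ℕ, s ∣ Nat.fib (2 * n + 1) ∧
    (ξ = s * ((3 + √5) / 2) ∨ ξ = s * ((5 + √5) / 2))) ∨
  (∃ s n : ℕ, s ∣ pellNumber (2 * n + 1) ∧ ξ = s * (2 + √2))

/-! Attach to `p/q` the element `p - q ξ̄` of `ℤ[ξ]`, whose norm is `p² - tpq - uq²`. Then `f_ξ(x) =
t + u/x` is multiplication by `ξ`, and `∞` is the element `1`. With `b = sq` the scale `s` drops
out: put `η = ξ/s`, so `η² = v(mη + ε)` with `mη + ε` a unit of norm 1. Hence `f_ξ²` acts as this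
unit, and dividing by it shrinks any solution with `b > m` (`descent_step`). The small solutions are
`f_ξ(∞)`, `f_ξ²(∞)`, or have norm `-1` with `ε = -1` and `(v, m)` one of `(5,1)`, `(1,3)`, `(2,2)`.
In those families a norm `-1` solution makes `s` divide an odd-index Fibonacci or Pell number, so
`ξ` is exceptional.

Conversely, `f_ξ` multiplies norms by `-u`, up to squares. When `u < 0` the orbit therefore has
positive norm and misses every solution of norm `-1`. Exceptional `ξ` have such solutions, and
Legendre's criterion makes suitable ones convergents. -/

/-! ### Descent on solutions of `p² - vmpb - εvb² = ±1` -/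

/-- Classification of the solutions with `b ≤ m`, for `ε = 1`. -/
theorem small_solution_of_pos {v m p b ν : ℤ} (hv : 0 < v) (hm : 0 < m) (hb : 0 < b)
    (hpb : v * m * b < 2 * p) (hν : ν = 1 ∨ ν = -1)
    (h : p ^ 2 - v * m * p * b - v * b ^ 2 = ν) (hbm : b ≤ m) :
    (v = 1 ∧ b = 1 ∧ p = m) ∨ (b = m ∧ p = v * m ^ 2 + 1) := by
  have hvb : 0 < v * b := by positivity
  have hvmb : 0 < v * m * b := by positivity
  have hvb2 : 0 < v * b ^ 2 := by positivity
  have hle : v * b ^ 2 ≤ v * m * b := by nlinarith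
  -- The equation factors as `c * p = vb² + ν`; as `b ≤ m`, only `c = 0` and `c = 1` survive.
  obtain ⟨c, hc⟩ : ∃ c, c = p - v * m * b := ⟨_, rfl⟩
  have hcp : c * p = v * b ^ 2 + ν := by rw [hc]; linarith
  have hp : 0 < p := by linarith
  have hν1 : -1 ≤ ν ∧ ν ≤ 1 := by omega
  have hc0 : 0 ≤ c := by
    by_contra hlt
    nlinarith
  have hc2 : c < 2 := by
    by_contra hge
    nlinarith
  have hc01 : c = 0 ∨ c = 1 := by omega
  rcases hc01 with h0 | h1
  · left
    have hvb1 : v * b ^ 2 = 1 := by rw [h0] at hcp; omega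
    have hv1 : v = 1 := Int.eq_one_of_mul_eq_one_right hv.le hvb1
    have hb1 : b = 1 := by
      rw [hv1] at hvb1
      nlinarith
    refine ⟨hv1, hb1, ?_⟩
    rw [hv1, hb1] at hc
    linarith
  · right
    have hmb : m = b := by
      by_contra hne
      have : b + 1 ≤ m := by omega
      nlinarith
    subst hmb
    refine ⟨rfl, ?_⟩
    rw [h1] at hc
    linear_combination -hc

/-- Classification of the solutions with `b ≤ m`, for `ε = -1`. -/
theorem small_solution_of_neg {v m p b ν : ℤ} (hv : 0 < v) (hm : 0 < m) (hvm : 4 < v * m ^ 2)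
    (hb : 0 < b) (hpb : v * m * b < 2 * p) (hν : ν = 1 ∨ ν = -1)
    (h : p ^ 2 - v * m * p * b + v * b ^ 2 = ν) (hbm : b ≤ m) :
    (v = 1 ∧ b = 1 ∧ p = m) ∨ (b = m ∧ p = v * m ^ 2 - 1) ∨
      (ν = -1 ∧ ((v = 5 ∧ m = 1) ∨ (v = 1 ∧ m = 3) ∨ (v = 2 ∧ m = 2))) := by
  have hvb : 0 < v * b := by positivity
  have hvmb : 0 < v * m * b := by positivity
  have hvb2 : 0 < v * b ^ 2 := by positivity
  obtain ⟨e, he⟩ : ∃ e, e = v * m * b - p := ⟨_, rfl⟩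
  have hep : e * p = v * b ^ 2 - ν := by rw [he]; linarith
  have hp : 0 < p := by linarith
  have hlt : e < p := by linarith
  have hν1 : -1 ≤ ν ∧ ν ≤ 1 := by omega
  have he0 : 0 ≤ e := by
    by_contra hneg
    nlinarith
  rcases he0.eq_or_lt with h0 | h1
  · left
    have hvb1 : v * b ^ 2 = 1 := by rw [← h0] at hep; omega
    have hv1 : v = 1 := Int.eq_one_of_mul_eq_one_right hv.le hvb1
    have hb1 : b = 1 := by
      rw [hv1] at hvb1
      nlinarith
    refine ⟨hv1, hb1, ?_⟩
    rw [hv1, hb1] at he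
    linarith
  right
  -- From `e + p = vmb` and `ep = vb² - ν`: `(e-1)(p-1) + vb(m-b) = 1 - ν ≤ 2`, with both summands
  -- nonnegative.
  have hprod : 0 ≤ (e - 1) * (p - 1) := mul_nonneg (by omega) (by omega)
  have hgap : v * b * (m - b) ≤ 1 - ν := by nlinarith
  rcases hbm.eq_or_lt with rfl | hbm
  · have hfac : (e - 1) * (p - 1) = 1 - ν := by linear_combination hep - he
    rcases hν with rfl | rfl
    · left
      have he1 : e = 1 := by
        rcases mul_eq_zero.1 (hfac.trans (by norm_num)) with h | h <;> omega
      refine ⟨rfl, ?_⟩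
      linear_combination he - he1
    · right
      refine ⟨rfl, ?_⟩
      have he2 : e = 2 := by
        have h1 : e - 1 ≠ 0 := by
          intro h0
          rw [h0] at hfac
          norm_num at hfac
        have h2 : e < 3 := by
          by_contra h3
          nlinarith
        omega
      rw [he2] at hfac he
      have h5 : v * b ^ 2 = 5 := by linear_combination hfac - he
      have hb3 : b < 3 := by
        by_contra h3
        nlinarith
      have hb12 : b = 1 ∨ b = 2 := by omega
      rcases hb12 with rfl | rfl <;> omega
  · right
    obtain ⟨g, rfl⟩ : ∃ g, m = b + g := ⟨m - b, by ring⟩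
    have hg : 0 < g := by omega
    rw [add_sub_cancel_left] at hgap
    have hν' : ν = -1 := by
      rcases hν with rfl | rfl
      · have : 0 < v * b * g := by positivity
        omega
      · rfl
    subst hν'
    refine ⟨rfl, ?_⟩
    have hbg : 0 < b * g := by positivity
    have hvg : 0 < v * g := by positivity
    have hv2 : v ≤ 2 := by nlinarith
    have hb2 : b ≤ 2 := by nlinarith
    have hg2 : g ≤ 2 := by nlinarith
    interval_cases v <;> interval_cases b <;> interval_cases g <;> simp_all

/-- Division by the unit `mξ + ε` makes a solution with `m < b` smaller. -/
theorem descent_step {v m ε p b ν : ℤ} (hv : 0 < v) (hm : 0 < m) (hε : ε = 1 ∨ ε = -1)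
    (hvm : ε = -1 → 4 < v * m ^ 2) (hpb : v * m * b < 2 * p)
    (hν : ν = 1 ∨ ν = -1) (h : p ^ 2 - v * m * p * b - ε * v * b ^ 2 = ν) (hbm : m < b) :
    0 < (v * m ^ 2 + ε) * b - m * p ∧ (v * m ^ 2 + ε) * b - m * p < b ∧
      v * m * ((v * m ^ 2 + ε) * b - m * p) < 2 * (ε * (p - v * m * b)) := by
  have hb : 0 < b := hm.trans hbm
  have hvm2 : 0 < v * m ^ 2 := by positivity
  have hε2 : ε ^ 2 = 1 := by rcases hε with rfl | rfl <;> norm_num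
  -- The solution becomes `(a + b√D)/2` and the unit `(T + m√D)/2`, with `T` its trace. The three
  -- claims are linear in `a` and `b`, and follow by comparing squares.
  obtain ⟨a, ha⟩ : ∃ a, a = 2 * p - v * m * b := ⟨_, rfl⟩
  obtain ⟨D, hD⟩ : ∃ D, D = v * (v * m ^ 2 + 4 * ε) := ⟨_, rfl⟩
  obtain ⟨T, hT⟩ : ∃ T, T = v * m ^ 2 + 2 * ε := ⟨_, rfl⟩
  have ha0 : 0 < a := by linarith
  have haD : a ^ 2 = D * b ^ 2 + 4 * ν := by rw [ha, hD]; linear_combination 4 * h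
  have hTD : T ^ 2 = D * m ^ 2 + 4 := by rw [hT, hD]; linear_combination 4 * hε2
  have hT3 : 3 ≤ T := by
    rcases hε with rfl | rfl
    · omega
    · have := hvm rfl
      omega
  have hD2 : 2 ≤ D := by
    rcases hε with rfl | rfl
    · nlinarith
    · have h4 := hvm rfl
      by_cases hv1 : v = 1
      · subst hv1
        have : 3 ≤ m := by
          by_contra hlt
          nlinarith
        nlinarith
      · have : 2 ≤ v := by omega
        nlinarith
  have hsq : m ^ 2 + 3 ≤ b ^ 2 := by nlinarith
  have hm2 : 0 < m ^ 2 := by positivity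
  have hν1 : -1 ≤ ν ∧ ν ≤ 1 := by omega
  have hνm : ν * m ^ 2 ≤ m ^ 2 ∧ -m ^ 2 ≤ ν * m ^ 2 := by constructor <;> nlinarith
  have h1 : m * a < T * b := by
    refine lt_of_pow_lt_pow_left₀ 2 (by positivity) ?_
    rw [mul_pow, mul_pow, haD, hTD]
    nlinarith
  have h2 : (T - 2) * b < m * a := by
    refine lt_of_pow_lt_pow_left₀ 2 (by positivity) ?_
    have : (m * a) ^ 2 - ((T - 2) * b) ^ 2 = 4 * (T - 2) * b ^ 2 + 4 * (ν * m ^ 2) := by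
      rw [mul_pow, haD]
      linear_combination -b ^ 2 * hTD
    nlinarith
  have h3 : b * D * m < a * T := by
    refine lt_of_pow_lt_pow_left₀ 2 (by positivity) ?_
    have : (a * T) ^ 2 - (b * D * m) ^ 2 = 4 * D * (b ^ 2 + ν * m ^ 2) + 16 * ν := by
      rw [mul_pow, haD, hTD]
      ring
    nlinarith
  have e1 : 2 * ((v * m ^ 2 + ε) * b - m * p) = T * b - m * a := by
    rw [hT, ha]
    ring
  have e2 : 2 * (2 * (ε * (p - v * m * b)) - v * m * ((v * m ^ 2 + ε) * b - m * p))
      = a * T - b * D * m := by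
    rw [hT, ha, hD]
    ring
  refine ⟨by linarith, by linarith, by linarith⟩

/-! ### Fibonacci and Pell numbers as solutions of norm equations -/

theorem fib_two_mul_add_one_identity (n : ℕ) :
    (Nat.fib (2 * n) : ℤ) ^ 2 + Nat.fib (2 * n) * Nat.fib (2 * n + 1)
      - (Nat.fib (2 * n + 1) : ℤ) ^ 2 = -1 := by
  induction n with
  | zero => simp
  | succ n ih =>
    have h1 : (Nat.fib (2 * (n + 1)) : ℤ) = Nat.fib (2 * n) + Nat.fib (2 * n + 1) := by
      exact_mod_cast Nat.fib_add_two
    have h2 : (Nat.fib (2 * (n + 1) + 1) : ℤ) = Nat.fib (2 * n + 1) + Nat.fib (2 * (n + 1)) := by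
      exact_mod_cast Nat.fib_add_two
    rw [h2, h1]
    linear_combination ih

theorem pellNumber_two_mul_add_one_identity (n : ℕ) :
    (pellNumber (2 * n) : ℤ) ^ 2 + 2 * pellNumber (2 * n) * pellNumber (2 * n + 1)
      - (pellNumber (2 * n + 1) : ℤ) ^ 2 = -1 := by
  induction n with
  | zero => simp [pellNumber]
  | succ n ih =>
    have h1 : (pellNumber (2 * (n + 1)) : ℤ) = 2 * pellNumber (2 * n + 1) + pellNumber (2 * n) := by
      rw [show 2 * (n + 1) = 2 * n + 2 by ring, pellNumber]
      push_cast
      ring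
    have h2 : (pellNumber (2 * (n + 1) + 1) : ℤ)
        = 2 * pellNumber (2 * (n + 1)) + pellNumber (2 * n + 1) := by
      rw [show 2 * (n + 1) + 1 = 2 * n + 1 + 2 by ring, pellNumber]
      push_cast
      rfl
    rw [h2, h1]
    linear_combination ih

/-- Descent by `(x, y) ↦ (2x - y, y - x)`, the inverse of advancing the Fibonacci index by two; it
ends at `(0, 1)`. -/
theorem exists_eq_fib_of_norm_eq_neg_one {x y : ℤ} (hy : 0 < y) (hx : -y < 2 * x)
    (h : x ^ 2 + x * y - y ^ 2 = -1) : ∃ n : ℕ, y = Nat.fib (2 * n + 1) := by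
  suffices H : ∀ N : ℕ, ∀ x y : ℤ, 0 ≤ x → 0 < y → y ≤ N → x ^ 2 + x * y - y ^ 2 = -1 →
      ∃ n : ℕ, x = Nat.fib (2 * n) ∧ y = Nat.fib (2 * n + 1) by
    have hx0 : 0 ≤ x := by
      by_contra hneg
      nlinarith
    obtain ⟨n, -, hn⟩ := H y.toNat x y hx0 hy (by omega) h
    exact ⟨n, hn⟩
  intro N
  induction N with
  | zero =>
    intro x y _ hy hyN
    omega
  | succ N ih =>
    intro x y hx hy hyN h
    rcases hx.eq_or_lt with rfl | hx
    · refine ⟨0, by simp, ?_⟩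
      have : y = 1 := by nlinarith
      simp [this]
    · have hxy : x < y := by
        by_contra hle
        nlinarith
      have hyx : 0 ≤ 2 * x - y := by
        by_contra hlt
        nlinarith
      obtain ⟨n, h1, h2⟩ := ih (2 * x - y) (y - x) hyx (by omega) (by push_cast at hyN; omega)
        (by linear_combination h)
      have e1 : (Nat.fib (2 * (n + 1)) : ℤ) = Nat.fib (2 * n) + Nat.fib (2 * n + 1) := by
        exact_mod_cast Nat.fib_add_two
      have e2 : (Nat.fib (2 * (n + 1) + 1) : ℤ)
          = Nat.fib (2 * n + 1) + Nat.fib (2 * (n + 1)) := by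
        exact_mod_cast Nat.fib_add_two
      exact ⟨n + 1, by omega, by omega⟩

/-- The same descent, stepping the Pell index back by two. -/
theorem exists_eq_pellNumber_of_norm_eq_neg_one {x y : ℤ} (hy : 0 < y) (hx : -y < x)
    (h : x ^ 2 + 2 * x * y - y ^ 2 = -1) : ∃ n : ℕ, y = pellNumber (2 * n + 1) := by
  suffices H : ∀ N : ℕ, ∀ x y : ℤ, 0 ≤ x → 0 < y → y ≤ N → x ^ 2 + 2 * x * y - y ^ 2 = -1 →
      ∃ n : ℕ, x = pellNumber (2 * n) ∧ y = pellNumber (2 * n + 1) by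
    have hx0 : 0 ≤ x := by
      by_contra hneg
      nlinarith
    obtain ⟨n, -, hn⟩ := H y.toNat x y hx0 hy (by omega) h
    exact ⟨n, hn⟩
  intro N
  induction N with
  | zero =>
    intro x y _ hy hyN
    omega
  | succ N ih =>
    intro x y hx hy hyN h
    rcases hx.eq_or_lt with rfl | hx
    · refine ⟨0, by simp [pellNumber], ?_⟩
      have : y = 1 := by nlinarith
      simp [this, pellNumber]
    · have hxy : 2 * x < y := by
        by_contra hle
        nlinarith
      have hyx : 0 ≤ 5 * x - 2 * y := by
        by_contra hlt
        nlinarith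
      obtain ⟨n, h1, h2⟩ := ih (5 * x - 2 * y) (y - 2 * x) hyx (by omega)
        (by push_cast at hyN; omega) (by linear_combination h)
      have e1 : pellNumber (2 * (n + 1)) = 2 * pellNumber (2 * n + 1) + pellNumber (2 * n) := by
        rw [show 2 * (n + 1) = 2 * n + 2 by ring, pellNumber]
      have e2 : pellNumber (2 * (n + 1) + 1)
          = 2 * pellNumber (2 * (n + 1)) + pellNumber (2 * n + 1) := by
        rw [show 2 * (n + 1) + 1 = 2 * n + 1 + 2 by ring, pellNumber]
        rfl
      exact ⟨n + 1, by omega, by omega⟩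

/-! ### The orbit of `∞` -/

theorem lftXi_infty (d k : ℝ) : lftXi d k OnePoint.infty = ((2 * d : ℝ) : OnePoint ℝ) := rfl

theorem lftXi_coe (d k : ℝ) {x : ℝ} (hx : x ≠ 0) :
    lftXi d k (x : OnePoint ℝ) = ((2 * d + (k - d ^ 2) / x : ℝ) : OnePoint ℝ) :=
  if_neg hx

theorem map_mem_orbitInfty {f : OnePoint ℝ → OnePoint ℝ} {y : OnePoint ℝ}
    (hy : y ∈ orbitInfty f) : f y ∈ orbitInfty f := by
  obtain ⟨n, hn, rfl⟩ := hy
  exact ⟨n + 1, by omega, Function.iterate_succ_apply' f n _⟩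

theorem map_infty_mem_orbitInfty (f : OnePoint ℝ → OnePoint ℝ) :
    f OnePoint.infty ∈ orbitInfty f :=
  ⟨1, le_rfl, rfl⟩

/-- The solutions of `p² - vmpb - εvb² = ±1` lie in the orbit of `∞`, up to scaling, except for
solutions of norm `-1` in three families. -/
theorem mem_orbitInfty_or_of_norm_eq {v m ε : ℤ} {s d k : ℝ} (hs : 0 < s) (hv : 0 < v)
    (hm : 0 < m) (hε : ε = 1 ∨ ε = -1) (hvm : ε = -1 → 4 < v * m ^ 2)
    (hd : 2 * d = s * v * m) (hk : k - d ^ 2 = ε * s ^ 2 * v) {ν : ℤ} (hν : ν = 1 ∨ ν = -1)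
    {p b : ℤ} (hb : 0 < b) (hpb : v * m * b < 2 * p)
    (h : p ^ 2 - v * m * p * b - ε * v * b ^ 2 = ν) :
    ((s * p / b : ℝ) : OnePoint ℝ) ∈ orbitInfty (lftXi d k) ∨
      (ν = -1 ∧ ε = -1 ∧ ((v = 5 ∧ m = 1) ∨ (v = 1 ∧ m = 3) ∨ (v = 2 ∧ m = 2))) := by
  suffices H : ∀ N : ℕ, ∀ p b : ℤ, 0 < b → b ≤ N → v * m * b < 2 * p →
      p ^ 2 - v * m * p * b - ε * v * b ^ 2 = ν →
      ((s * p / b : ℝ) : OnePoint ℝ) ∈ orbitInfty (lftXi d k) ∨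
        (ν = -1 ∧ ε = -1 ∧ ((v = 5 ∧ m = 1) ∨ (v = 1 ∧ m = 3) ∨ (v = 2 ∧ m = 2))) from
    H b.toNat p b hb (by omega) hpb h
  clear! p b
  have hε2 : ε ^ 2 = 1 := by rcases hε with rfl | rfl <;> norm_num
  have hvR : (0 : ℝ) < v := by exact_mod_cast hv
  have hmR : (0 : ℝ) < m := by exact_mod_cast hm
  intro N
  induction N with
  | zero =>
    intro p b hb hbN
    omega
  | succ N ih =>
    intro p b hb hbN hpb h
    have hbR : (0 : ℝ) < b := by exact_mod_cast hb
    rcases le_or_gt b m with hbm | hbm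
    · have hcases : (v = 1 ∧ b = 1 ∧ p = m) ∨ (b = m ∧ p = v * m ^ 2 + ε) ∨
          (ν = -1 ∧ ε = -1 ∧ ((v = 5 ∧ m = 1) ∨ (v = 1 ∧ m = 3) ∨ (v = 2 ∧ m = 2))) := by
        rcases hε with rfl | rfl
        · rcases small_solution_of_pos hv hm hb hpb hν (by linarith) hbm with h | h
          · exact Or.inl h
          · exact Or.inr (Or.inl h)
        · rcases small_solution_of_neg hv hm (hvm rfl) hb hpb hν (by linarith) hbm with h | h | h
          · exact Or.inl h
          · exact Or.inr (Or.inl h)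
          · exact Or.inr (Or.inr ⟨h.1, rfl, h.2⟩)
      have hdR : 2 * d ≠ 0 := by
        rw [hd]
        positivity
      rcases hcases with ⟨h1, h2, h3⟩ | ⟨h1, h2⟩ | h'
      · left
        have := map_infty_mem_orbitInfty (lftXi d k)
        rw [lftXi_infty, hd] at this
        convert this using 2
        rw [h1, h2, h3]
        norm_num
      · left
        have := map_mem_orbitInfty (map_infty_mem_orbitInfty (lftXi d k))
        rw [lftXi_infty, lftXi_coe d k hdR, hd, hk] at this
        convert this using 2
        rw [h1, h2]
        push_cast
        field_simp
      · exact Or.inr h'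
    · obtain ⟨h1, h2, h3⟩ := descent_step hv hm hε hvm hpb hν h hbm
      obtain ⟨b', hb'⟩ : ∃ b', b' = (v * m ^ 2 + ε) * b - m * p := ⟨_, rfl⟩
      obtain ⟨p', hp'⟩ : ∃ p', p' = ε * (p - v * m * b) := ⟨_, rfl⟩
      rw [← hb'] at h1 h2 h3
      rw [← hp'] at h3
      have hnorm : p' ^ 2 - v * m * p' * b' - ε * v * b' ^ 2 = ν := by
        rw [hp', hb']
        rcases hε with rfl | rfl <;> linear_combination h
      rcases ih p' b' h1 (by push_cast at hbN; omega) h3 hnorm with horb | h'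
      · left
        have hvmb : 0 < v * m * b' := by positivity
        have hp'0 : 0 < p' := by linarith
        have hb'R : (0 : ℝ) < b' := by exact_mod_cast h1
        have hp'R : (0 : ℝ) < p' := by exact_mod_cast hp'0
        have hbinv : b = m * p' + ε * b' := by
          rw [hp', hb']
          linear_combination -b * hε2
        have hpinv : p = (v * m ^ 2 + ε) * p' + ε * v * m * b' := by
          rw [hp', hb']
          linear_combination -p * hε2
        have hbinvR : (b : ℝ) = m * p' + ε * b' := by exact_mod_cast hbinv
        have hpinvR : (p : ℝ) = (v * m ^ 2 + ε) * p' + ε * v * m * b' := by exact_mod_cast hpinv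
        have hstep : 2 * d + (k - d ^ 2) / (s * p' / b') = s * v * b / p' := by
          rw [hd, hk, hbinvR]
          field_simp
        -- Two applications of the map multiply by the unit, undoing the descent step.
        have horb2 := map_mem_orbitInfty (map_mem_orbitInfty horb)
        rw [lftXi_coe d k (by positivity), hstep, lftXi_coe d k (by positivity), hd, hk] at horb2
        convert horb2 using 2
        rw [hpinvR]
        field_simp
        rw [hbinvR]
        ring
      · exact Or.inr h'

/-- If `u < 0`, the polynomial `x² - tx - u` is positive on the finite points of the orbit. -/
theorem norm_pos_of_mem_orbitInfty {t u : ℤ} {d k : ℝ} (ht : 0 < t) (hu : u < 0)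
    (hd : 2 * d = t) (hk : k - d ^ 2 = u) (hdisc : 0 < t ^ 2 + 4 * u) {x : ℝ}
    (hx : (x : OnePoint ℝ) ∈ orbitInfty (lftXi d k)) : 0 < x ^ 2 - t * x - u := by
  have htR : (0 : ℝ) < t := by exact_mod_cast ht
  have huR : (u : ℝ) < 0 := by exact_mod_cast hu
  have hdR : (0 : ℝ) < (t : ℝ) ^ 2 + 4 * u := by exact_mod_cast hdisc
  obtain ⟨n, hn, hnx⟩ := hx
  -- The bound `t < 2y` keeps the orbit away from `0`, hence finite, so that the sign of the norm
  -- propagates.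
  suffices H : ∀ n : ℕ, 1 ≤ n → ∃ y : ℝ, (lftXi d k)^[n] OnePoint.infty = (y : OnePoint ℝ) ∧
      t < 2 * y ∧ 0 < y ^ 2 - t * y - u by
    obtain ⟨y, hy, -, hpos⟩ := H n hn
    rw [hy, OnePoint.coe_eq_coe] at hnx
    exact hnx ▸ hpos
  intro n hn
  induction n, hn using Nat.le_induction with
  | base =>
    refine ⟨t, ?_, by linarith, by nlinarith⟩
    rw [Function.iterate_one, lftXi_infty, hd]
  | succ n _ ih =>
    obtain ⟨y, hy, hty, hpos⟩ := ih
    have hy0 : 0 < y := by linarith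
    refine ⟨t + u / y, ?_, ?_, ?_⟩
    · rw [Function.iterate_succ_apply', hy, lftXi_coe d k hy0.ne', hd, hk]
    · have : 2 * (t + u / y) - t = (t * y + 2 * u) / y := by
        field_simp
        ring
      have h2 : 0 < (t * y + 2 * u) / y := by
        apply div_pos _ hy0
        nlinarith
      linarith
    · have : (t + u / y) ^ 2 - t * (t + u / y) - u = -u * (y ^ 2 - t * y - u) / y ^ 2 := by
        field_simp
        ring
      rw [this]
      have : 0 < -(u : ℝ) := by linarith
      positivity

/-! ### Pellian fractions and convergents -/

/-- A solution of norm `-1` is a convergent of `ξ` if its denominator or the discriminant is not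
too small. -/
theorem isConvergent_of_norm_eq_neg_one {t u p q : ℤ} {ξ : ℝ} (hξ : ξ ^ 2 - t * ξ - u = 0)
    (htξ : t < 2 * ξ) (hq : 0 < q) (hpq : t * q < 2 * p)
    (hdisc : 5 ≤ t ^ 2 + 4 * u ∧ 2 ≤ q ∨ 8 ≤ t ^ 2 + 4 * u)
    (h : p ^ 2 - t * p * q - u * q ^ 2 = -1) : IsConvergent ξ p q := by
  have hqR : (1 : ℝ) ≤ q := by exact_mod_cast hq
  have hq0 : (0 : ℝ) < q := by linarith
  have hR : (p : ℝ) ^ 2 - t * p * q - u * q ^ 2 = -1 := by exact_mod_cast h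
  have hpqR : (t : ℝ) * q < 2 * p := by exact_mod_cast hpq
  obtain ⟨δ, hδ⟩ : ∃ δ, δ = 2 * ξ - t := ⟨_, rfl⟩
  have hδ0 : 0 < δ := by linarith
  have hδ2 : δ ^ 2 = t ^ 2 + 4 * u := by
    rw [hδ]
    linear_combination 4 * hξ
  have hbound : 1 < 2 * (δ - 2) * q ^ 2 := by
    rcases hdisc with ⟨h5, hq2⟩ | h8
    · have h5R : (5 : ℝ) ≤ t ^ 2 + 4 * u := by exact_mod_cast h5
      have hq2R : (2 : ℝ) ≤ q := by exact_mod_cast hq2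
      have : 2.2 < δ := by nlinarith
      nlinarith
    · have h8R : (8 : ℝ) ≤ t ^ 2 + 4 * u := by exact_mod_cast h8
      have : 2.8 < δ := by nlinarith
      nlinarith
  -- Here `y = p - ξ̄q` and `ξq - p = 1/y`, so Legendre's criterion needs exactly `y > 2q`.
  obtain ⟨y, hy⟩ : ∃ y, y = p - (t - ξ) * q := ⟨_, rfl⟩
  have hδy : δ * q < 2 * y := by
    rw [hδ, hy]
    linarith
  have hyz : y * (δ * q - y) = 1 := by
    rw [hy, hδ]
    linear_combination -hR + (q : ℝ) ^ 2 * hξ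
  have hy2 : 2 * q < y := by
    by_contra hle
    rw [not_lt] at hle
    have hδ4 : δ * q < 4 * q := by linarith
    -- If `y ≤ 2q`, then `y` lies between `(δ-2)q` and `2q`, so `y(δq - y)` is at least its endpoint
    -- value `2(δ-2)q² > 1`.
    have : 0 ≤ (2 * q - y) * (y - (δ - 2) * q) := mul_nonneg (by linarith) (by linarith)
    nlinarith
  have hy0 : 0 < y := by linarith
  have hdist : |ξ - ((p / q : ℚ) : ℝ)| < 1 / (2 * (q : ℝ) ^ 2) := by
    have h1 : ξ - ((p / q : ℚ) : ℝ) = 1 / (y * q) := by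
      push_cast
      rw [eq_div_iff (by positivity)]
      field_simp
      rw [← hyz, hδ, hy]
      ring
    rw [h1, abs_of_pos (by positivity)]
    apply one_div_lt_one_div_of_lt (by positivity)
    nlinarith
  have hden : ((p / q : ℚ).den : ℝ) ≤ q := by
    have := Int.le_of_dvd hq (Rat.den_dvd p q)
    rw [← Rat.divInt_eq_div]
    exact_mod_cast this
  have hden0 : (0 : ℝ) < (p / q : ℚ).den := by exact_mod_cast (p / q : ℚ).den_pos
  exact Real.exists_rat_eq_convergent (hdist.trans_le (by gcongr))

/-- Norm `-1` solutions give Pellian convergents outside the orbit of `∞` when `u < 0`. -/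
theorem isPellian_and_isConvergent_and_not_mem_orbitInfty {t u p q : ℤ} {d k ξ : ℝ} (ht : 0 < t)
    (hu : u < 0) (hd : 2 * d = t) (hk : k - d ^ 2 = u) (hξ : ξ = d + √k) (hq : 0 < q)
    (hdisc : 5 ≤ t ^ 2 + 4 * u ∧ 2 ≤ q ∨ 8 ≤ t ^ 2 + 4 * u) (hpq : t * q < 2 * p)
    (h : p ^ 2 - t * p * q - u * q ^ 2 = -1) :
    IsPellian ξ p q ∧ IsConvergent ξ p q ∧
      (((p : ℝ) / q : ℝ) : OnePoint ℝ) ∉ orbitInfty (lftXi d k) := by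
  have hqR : (0 : ℝ) < q := by exact_mod_cast hq
  have htR : (0 : ℝ) < t := by exact_mod_cast ht
  have hpqR : (t : ℝ) * q < 2 * p := by exact_mod_cast hpq
  have hR : (p : ℝ) ^ 2 - t * p * q - u * q ^ 2 = -1 := by exact_mod_cast h
  have hΔ : 0 < t ^ 2 + 4 * u := by omega
  have hk4 : 4 * k = t ^ 2 + 4 * u := by rw [← hd, ← hk]; ring
  have hk0 : 0 < k := by
    have : (0 : ℝ) < t ^ 2 + 4 * u := by exact_mod_cast hΔ
    linarith
  have hsq : √k ^ 2 = k := Real.sq_sqrt hk0.le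
  have hsq0 : 0 < √k := Real.sqrt_pos.2 hk0
  have hroot : ξ ^ 2 - t * ξ - u = 0 := by
    rw [hξ, ← hd, ← hk]
    linear_combination hsq
  have htξ : t < 2 * ξ := by rw [hξ]; linarith
  refine ⟨⟨t, u, hroot, ?_, hq, ?_, Or.inr h⟩,
    isConvergent_of_norm_eq_neg_one hroot htξ hq hpq hdisc h, fun hmem => ?_⟩
  · rw [abs_lt]
    constructor <;> linarith
  · rw [div_lt_div_iff₀ two_pos hqR]
    linarith
  · have hpos := norm_pos_of_mem_orbitInfty ht hu hd hk hΔ hmem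
    have : ((p : ℝ) / q) ^ 2 - t * (p / q) - u = -1 / q ^ 2 := by
      rw [← hR]
      field_simp
    rw [this] at hpos
    have : (-1 : ℝ) / q ^ 2 < 0 := div_neg_of_neg_of_pos (by norm_num) (by positivity)
    linarith

/-! ### Irrationality of `ξ` -/

/-- A square discriminant gives an integer root `j` of `x² - vmx - εv`. For `ε = 1` sizes exclude
it. For `ε = -1`, `v(jm - 1) = j²` with `jm - 1` prime to `j` forces `jm = 2`, hence `vm² = 4`. -/
theorem not_isSquare_disc {v m ε : ℤ} (hv : 0 < v) (hm : 0 < m) (hε : ε = 1 ∨ ε = -1)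
    (hvm : ε = -1 → 4 < v * m ^ 2) : ¬ IsSquare (v * (v * m ^ 2 + 4 * ε)) := by
  rintro ⟨w', hw'⟩
  obtain ⟨w, hw0, hw⟩ : ∃ w : ℤ, 0 ≤ w ∧ w ^ 2 = v ^ 2 * m ^ 2 + 4 * ε * v :=
    ⟨|w'|, abs_nonneg _, by rw [sq_abs]; linear_combination -hw'⟩
  have hvmpos : 0 < v * m := by positivity
  have hpar : Even (v * m - w) := by
    have : Even ((v * m) ^ 2 - w ^ 2) := ⟨-(2 * ε * v), by linear_combination -hw⟩
    rw [Int.even_sub, Int.even_pow' two_ne_zero, Int.even_pow' two_ne_zero] at this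
    rwa [Int.even_sub]
  obtain ⟨j, hj⟩ := hpar
  obtain rfl : w = v * m - 2 * j := by linarith
  have hj2 : j ^ 2 - v * m * j = ε * v := by linarith
  rcases hε with rfl | rfl
  · have h1 : j < 0 := by
      by_contra hge
      nlinarith
    nlinarith
  · have h1 : 0 < j := by
      by_contra hle
      nlinarith
    have hfac : v * (j * m - 1) = j ^ 2 := by linear_combination -hj2
    have hcop : IsCoprime (j * m - 1) (j ^ 2) :=
      IsCoprime.pow_right ⟨-1, m, by ring⟩
    have hunit : IsUnit (j * m - 1) := hcop.isUnit_of_dvd' dvd_rfl ⟨v, by linear_combination -hfac⟩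
    have hjm : 0 < j * m := by positivity
    have h2 : j * m = 2 := by
      rcases Int.isUnit_iff.1 hunit with h | h <;> omega
    have hj2' : j ≤ 2 := by nlinarith
    have h4 := hvm rfl
    rw [h2] at hfac
    have hj12 : j = 1 ∨ j = 2 := by omega
    rcases hj12 with rfl | rfl
    · obtain rfl : m = 2 := by omega
      omega
    · obtain rfl : m = 1 := by omega
      omega

/-- An irrational number satisfies at most one monic integral quadratic equation. -/
theorem monic_quadratic_unique {ξ : ℝ} (hξ : Irrational ξ) {t u t' u' : ℤ}
    (h : ξ ^ 2 - t * ξ - u = 0) (h' : ξ ^ 2 - t' * ξ - u' = 0) : t = t' ∧ u = u' := by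
  have hlin : ((t - t' : ℤ) : ℝ) * ξ = (u' - u : ℤ) := by
    push_cast
    linear_combination h' - h
  have ht : t = t' := by
    by_contra hne
    exact (hξ.intCast_mul (sub_ne_zero.2 hne)).ne_int _ hlin
  refine ⟨ht, ?_⟩
  rw [ht, sub_self, Int.cast_zero, zero_mul] at hlin
  have : u' - u = 0 := by exact_mod_cast hlin.symm
  omega

theorem sqrt_eq_mul_of_sq {k c x : ℝ} (hc : 0 ≤ c) (hk : k = c ^ 2 * x) : √k = c * √x := by
  rw [hk, Real.sqrt_mul (sq_nonneg c), Real.sqrt_sq hc]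

theorem irrational_add_sqrt {s v m ε : ℤ} (hs : 0 < s) (hv : 0 < v) (hm : 0 < m)
    (hε : ε = 1 ∨ ε = -1) (hvm : ε = -1 → 4 < v * m ^ 2) {d k : ℝ} (hd : 2 * d = s * v * m)
    (hk : 4 * k = s ^ 2 * v * (v * m ^ 2 + 4 * ε)) : Irrational (d + √k) := by
  have hsq := not_isSquare_disc hv hm hε hvm
  have hsR : (0 : ℝ) ≤ s := by exact_mod_cast hs.le
  have hD0 : 0 ≤ v * (v * m ^ 2 + 4 * ε) := by
    apply mul_nonneg hv.le
    rcases hε with rfl | rfl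
    · positivity
    · linarith [hvm rfl]
  have hirr : Irrational √((v * (v * m ^ 2 + 4 * ε) : ℤ) : ℝ) :=
    (irrational_sqrt_intCast_iff_of_nonneg hD0).2 hsq
  have hsqrt : 2 * √k = s * √((v * (v * m ^ 2 + 4 * ε) : ℤ) : ℝ) := by
    rw [sqrt_eq_mul_of_sq (c := s / 2) (x := (v * (v * m ^ 2 + 4 * ε) : ℤ)) (by positivity)
      (by push_cast; linear_combination hk / 4)]
    ring
  have h2 := (hirr.intCast_mul hs.ne').intCast_add (s * v * m)
  rw [← hsqrt] at h2
  have h3 : ((s * v * m : ℤ) : ℝ) + 2 * √k = (2 : ℤ) * (d + √k) := by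
    push_cast
    linear_combination -hd
  rw [h3] at h2
  exact h2.of_intCast_mul _

/-! ### Divisors of odd-index Pell and Fibonacci numbers -/

theorem pellNumber_pos (n : ℕ) : 0 < pellNumber (n + 1) := by
  induction n with
  | zero => simp [pellNumber]
  | succ n ih =>
    rw [pellNumber]
    omega

/-- A divisor of a Fibonacci number of odd index divides one with quotient at least two. -/
theorem exists_mul_eq_fib {r n : ℕ} (h : r ∣ Nat.fib (2 * n + 1)) :
    0 < r ∧ ∃ q l : ℕ, 2 ≤ q ∧ r * q = Nat.fib (2 * l + 1) := by
  have hpos : 0 < Nat.fib (2 * n + 1) := Nat.fib_pos.2 (by omega)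
  have hr : 0 < r := Nat.pos_of_dvd_of_pos h hpos
  refine ⟨hr, ?_⟩
  -- Tripling the index keeps it odd and at least doubles the Fibonacci number. Quotient 1 must be
  -- avoided because the convergent criterion for discriminant 5 asks for `2 ≤ q`.
  obtain ⟨q, hq⟩ := h.trans (Nat.fib_dvd (2 * n + 1) (2 * (3 * n + 1) + 1) ⟨3, by ring⟩)
  refine ⟨q, 3 * n + 1, ?_, hq.symm⟩
  have h1 : Nat.fib (2 * n + 1 + 2) ≤ Nat.fib (2 * (3 * n + 1) + 1) := Nat.fib_mono (by omega)
  have h2 : Nat.fib (2 * n + 1) ≤ Nat.fib (2 * n + 1 + 1) := Nat.fib_le_fib_succ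
  rw [Nat.fib_add_two, hq] at h1
  have h3 : r ≤ Nat.fib (2 * n + 1) := Nat.le_of_dvd hpos h
  by_contra hlt
  have : q ≤ 1 := by omega
  nlinarith

/-! ### The main theorem -/

theorem theorem6p5 (s v m : ℕ) (hs : 0 < s) (hv : 0 < v) (hm : 0 < m)
    (ε : ℤ) (hε : ε = 1 ∨ ε = -1)
    (hirr : ε = -1 → 4 < v * m ^ 2)
    (d k : ℚ) (hd : d = (s * v * m : ℚ) / 2)
    (hk : k = (s ^ 2 * v * (v * m ^ 2 + 4 * ε) : ℚ) / 4)
    (ξ : ℝ) (hξ : ξ = (d : ℝ) + √(k : ℝ)) :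
    (¬ IsExceptional ξ → ∀ p q : ℤ, IsPellian ξ p q →
      (((p : ℝ) / q : ℝ) : OnePoint ℝ) ∈ orbitInfty (lftXi d k)) ∧
    (IsExceptional ξ → ∃ p q : ℤ, IsPellian ξ p q ∧ IsConvergent ξ p q ∧
      (((p : ℝ) / q : ℝ) : OnePoint ℝ) ∉ orbitInfty (lftXi d k)) := by
  have hsZ : (0 : ℤ) < s := by exact_mod_cast hs
  have hvZ : (0 : ℤ) < v := by exact_mod_cast hv
  have hmZ : (0 : ℤ) < m := by exact_mod_cast hm
  have hsR : (0 : ℝ) < s := by exact_mod_cast hs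
  have hvm : ε = -1 → 4 < (v : ℤ) * (m : ℤ) ^ 2 := fun h => by exact_mod_cast hirr h
  have hdR : 2 * (d : ℝ) = s * v * m := by rw [hd]; push_cast; ring
  have hkR : 4 * (k : ℝ) = s ^ 2 * v * (v * m ^ 2 + 4 * ε) := by rw [hk]; push_cast; ring
  have hkd : (k : ℝ) - (d : ℝ) ^ 2 = ε * s ^ 2 * v := by
    linear_combination hkR / 4 - (2 * (d : ℝ) + s * v * m) / 4 * hdR
  have hξirr : Irrational ξ := by
    rw [hξ]
    exact irrational_add_sqrt hsZ hvZ hmZ hε hvm (by exact_mod_cast hdR) (by exact_mod_cast hkR)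
  have hk0 : (0 : ℝ) ≤ k := by
    have : (0 : ℝ) ≤ v * m ^ 2 + 4 * ε := by
      rcases hε with rfl | rfl
      · push_cast
        positivity
      · have : (4 : ℝ) < v * m ^ 2 := by exact_mod_cast hirr rfl
        push_cast
        linarith
    have : (0 : ℝ) ≤ 4 * k := by
      rw [hkR]
      positivity
    linarith
  have hroot : ξ ^ 2 - ((s * v * m : ℤ) : ℝ) * ξ - ((ε * s ^ 2 * v : ℤ) : ℝ) = 0 := by
    push_cast
    rw [← hdR, ← hkd, hξ]
    linear_combination Real.sq_sqrt hk0
  constructor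
  · rintro hexc p q ⟨t, u, htu, -, hq, hpq, hnorm⟩
    obtain ⟨rfl, rfl⟩ := monic_quadratic_unique hξirr hroot htu
    have hqR : (0 : ℝ) < q := by exact_mod_cast hq
    have hpq' : (v : ℤ) * m * (s * q) < 2 * p := by
      rw [div_lt_div_iff₀ two_pos hqR] at hpq
      have : (s * v * m : ℤ) * q < p * 2 := by exact_mod_cast hpq
      linarith
    obtain ⟨ν, hν, hνeq⟩ : ∃ ν : ℤ, (ν = 1 ∨ ν = -1) ∧
        p ^ 2 - v * m * p * (s * q) - ε * v * (s * q) ^ 2 = ν := by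
      rcases hnorm with h | h
      · exact ⟨1, Or.inl rfl, by linear_combination h⟩
      · exact ⟨-1, Or.inr rfl, by linear_combination h⟩
    have hb : 0 < (s : ℤ) * q := by positivity
    rcases mem_orbitInfty_or_of_norm_eq (d := d) (k := k) hsR hvZ hmZ hε hvm
      (by exact_mod_cast hdR) (by exact_mod_cast hkd) hν hb hpq' hνeq with h | ⟨rfl, rfl, h⟩
    · convert h using 2
      push_cast
      field_simp
    · refine absurd ?_ hexc
      have hs2 : (0 : ℝ) ≤ s / 2 := by positivity
      rcases h with ⟨h1, h2⟩ | ⟨h1, h2⟩ | ⟨h1, h2⟩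
      all_goals
        obtain rfl : v = _ := Int.natCast_inj.1 h1
        obtain rfl : m = _ := Int.natCast_inj.1 h2
        push_cast at hνeq hpq' hdR hkR
      -- The shift by `3b` turns `p² - 5pb + 5b²` into the Fibonacci form `x² + xb - b²`; the other
      -- two cases use similar shifts.
      · obtain ⟨n, hn⟩ := exists_eq_fib_of_norm_eq_neg_one (x := p - 3 * (s * q)) hb
          (by linarith) (by linear_combination hνeq)
        refine Or.inl ⟨s, n, Int.natCast_dvd_natCast.1 ⟨q, hn.symm⟩, Or.inr ?_⟩
        rw [hξ, sqrt_eq_mul_of_sq (x := 5) hs2 (by linear_combination hkR / 4)]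
        linear_combination hdR / 2
      · obtain ⟨n, hn⟩ := exists_eq_fib_of_norm_eq_neg_one (x := p - 2 * (s * q)) hb
          (by linarith) (by linear_combination hνeq)
        refine Or.inl ⟨s, n, Int.natCast_dvd_natCast.1 ⟨q, hn.symm⟩, Or.inl ?_⟩
        rw [hξ, sqrt_eq_mul_of_sq (x := 5) hs2 (by linear_combination hkR / 4)]
        linear_combination hdR / 2
      · obtain ⟨n, hn⟩ := exists_eq_pellNumber_of_norm_eq_neg_one (x := p - 3 * (s * q)) hb
          (by linarith) (by linear_combination hνeq)
        refine Or.inr ⟨s, n, Int.natCast_dvd_natCast.1 ⟨q, hn.symm⟩, ?_⟩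
        rw [hξ, sqrt_eq_mul_of_sq (x := 2) hsR.le (by linear_combination hkR / 4)]
        linear_combination hdR / 2
  · have h5 : √5 ^ 2 = 5 := Real.sq_sqrt (by norm_num)
    have h2 : √2 ^ 2 = 2 := Real.sq_sqrt (by norm_num)
    rintro (⟨r, n, hr, hcase⟩ | ⟨r, n, hr, hcase⟩)
    · obtain ⟨hr0, q, l, hq, hfib⟩ := exists_mul_eq_fib hr
      have hr1 : (1 : ℤ) ≤ r := by exact_mod_cast hr0
      have hr2 : (1 : ℤ) ≤ (r : ℤ) ^ 2 := one_le_pow₀ hr1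
      have hq2 : (2 : ℤ) ≤ q := by exact_mod_cast hq
      have hid := fib_two_mul_add_one_identity l
      have hfibZ : (Nat.fib (2 * l + 1) : ℤ) = r * q := by exact_mod_cast hfib.symm
      have hrq : 0 < (r : ℤ) * q := by positivity
      rw [hfibZ] at hid
      obtain ⟨x, hx⟩ : ∃ x : ℤ, x = Nat.fib (2 * l) := ⟨_, rfl⟩
      rw [← hx] at hid
      have hx0 : 0 ≤ x := by omega
      rcases hcase with hcase | hcase
      · obtain ⟨ht, hu⟩ := monic_quadratic_unique hξirr (t' := 3 * r) (u' := -r ^ 2) hroot (by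
          rw [hcase]
          push_cast
          linear_combination (r : ℝ) ^ 2 / 4 * h5)
        -- The witness reverses the shift used in the other direction; the discriminant is `5r²`.
        refine ⟨2 * (r * q) + x, q, isPellian_and_isConvergent_and_not_mem_orbitInfty
          (t := 3 * r) (u := -r ^ 2) (by linarith) (by linarith) ?_ ?_ hξ (by linarith)
          (Or.inl ⟨by linarith, hq2⟩) (by linarith) (by linear_combination hid)⟩
        · rw [← ht, hdR]
          push_cast
          rfl
        · rw [← hu, hkd]
          push_cast
          rfl
      · obtain ⟨ht, hu⟩ := monic_quadratic_unique hξirr (t' := 5 * r) (u' := -5 * r ^ 2) hroot (by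
          rw [hcase]
          push_cast
          linear_combination (r : ℝ) ^ 2 / 4 * h5)
        refine ⟨3 * (r * q) + x, q, isPellian_and_isConvergent_and_not_mem_orbitInfty
          (t := 5 * r) (u := -5 * r ^ 2) (by linarith) (by linarith) ?_ ?_ hξ (by linarith)
          (Or.inl ⟨by linarith, hq2⟩) (by linarith) (by linear_combination hid)⟩
        · rw [← ht, hdR]
          push_cast
          rfl
        · rw [← hu, hkd]
          push_cast
          rfl
    · have hpos := pellNumber_pos (2 * n)
      have hr0 : 0 < r := Nat.pos_of_dvd_of_pos hr hpos
      obtain ⟨q, hq⟩ := hr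
      have hq0 : 0 < q := by
        rw [hq] at hpos
        exact Nat.pos_of_mul_pos_left hpos
      have hr1 : (1 : ℤ) ≤ r := by exact_mod_cast hr0
      have hr2 : (1 : ℤ) ≤ (r : ℤ) ^ 2 := one_le_pow₀ hr1
      have hq1 : (1 : ℤ) ≤ q := by exact_mod_cast hq0
      have hid := pellNumber_two_mul_add_one_identity n
      have hpellZ : (pellNumber (2 * n + 1) : ℤ) = r * q := by exact_mod_cast hq
      have hrq : 0 < (r : ℤ) * q := by positivity
      rw [hpellZ] at hid
      obtain ⟨x, hx⟩ : ∃ x : ℤ, x = pellNumber (2 * n) := ⟨_, rfl⟩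
      rw [← hx] at hid
      have hx0 : 0 ≤ x := by omega
      obtain ⟨ht, hu⟩ := monic_quadratic_unique hξirr (t' := 4 * r) (u' := -2 * r ^ 2) hroot (by
        rw [hcase]
        push_cast
        linear_combination (r : ℝ) ^ 2 * h2)
      -- The discriminant is `8r²`, so `q = 1` is harmless here.
      refine ⟨3 * (r * q) + x, q, isPellian_and_isConvergent_and_not_mem_orbitInfty
        (t := 4 * r) (u := -2 * r ^ 2) (by linarith) (by linarith) ?_ ?_ hξ (by linarith)
        (Or.inr (by linarith)) (by linarith) (by linear_combination hid)⟩
      · rw [← ht, hdR]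
        push_cast
        rfl
      · rw [← hu, hkd]
        push_cast
        rfl
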